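/- **Setting.** Let $\operatorname{SE}_3$ be the group of matrices $\begin{pmatrix}R&w\\0&1\end{pmatrix}$ with $R\in\operatorname{SO}_3$, $w\in\mathbb R^3$, and $\mathfrak{se}_3$ its Lie algebra with the commutator bracket. For $x\in\mathbb R^6$ put $$\operatorname{mat}_{\mathfrak{se}}(x)=\begin{pmatrix}\operatorname{mat}_{\mathfrak{so}}(x_{1:3})&x_{4:6}\\0&0\end{pmatrix},\qquad \operatorname{mat}_{\mathfrak{so}}(w)=\tfrac1{\sqrt2}\begin{pmatrix}0&-w_3&w_2\\w_3&0&-w_1\\-w_2&w_1&0\end{pmatrix},$$ $\operatorname{vec}_{\mathfrak{se}}=\operatorname{mat}_{\mathfrak{se}}^{-1}$, and let $\operatorname{Pr}:\mathbb R^{4\times4}\to\mathfrak{se}_3$, $\operatorname{Pr}(A)=\frac12 D\,(A\operatorname{diag}(1,1,1,2)-A^\top D)$ with $D=\operatorname{diag}(1,1,1,0)$. Let $\mathcal G=\operatorname{SE}_3\times\mathbb R^6$ (product group, $\mathbb R^6$ additive), $\mathfrak g=\mathfrak{se}_3\times\mathbb R^6$, $\operatorname{vec}_{\mathfrak g}(\eta_1,\eta_2)=(\operatorname{vec}_{\mathfrak{se}}\eta_1,\eta_2)\in\mathbb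 R^{12}$, $\operatorname{mat}_{\mathfrak g}=\operatorname{vec}_{\mathfrak g}^{-1}$, $\operatorname{Exp}(\eta_1,\eta_2)=(e^{\eta_1},\eta_2)$, and $G\eta=(E\eta_1,\eta_2)$ for $G=(E,v)\in\mathcal G$, $\eta\in\mathfrak g$. Write $\operatorname{ad}_{\mathfrak g}(x)\in\mathbb R^{12\times12}$ for the matrix of $\operatorname{ad}(\operatorname{mat}_{\mathfrak g}x)$ in the coordinates $\operatorname{vec}_{\mathfrak g}$, and, for $\varphi:\mathcal G\to\mathbb R^p$, write $\mathbf d\varphi(G)\in\mathbb R^{p\times12}$ for the matrix of the derivative of $x\mapsto\varphi(G\operatorname{Exp}(\operatorname{mat}_{\mathfrak g}x))$ at $x=0$. **The filter.** Let $f:\mathcal G\to\mathfrak g$, $h:\mathcal G\to\mathbb R^p$. For the state equation $\dot G=G(f(G)+\delta)$, with white noise $\delta$ of covariance $S\in\mathbb R^{12\times12}$ (in the coordinates $\operatorname{vec}_{\mathfrak g}$), and the observation $z=h(G(t_l))+\varepsilon$, with noise $\varepsilon$ of covariance $Q_l$, one step of the continuous-discrete extended Kalman filter (CD-LG-EKF)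 on $\mathcal G$, from $(G(t_{l-1}),P(t_{l-1}))$ to $(G(t_l),P(t_l))$, is as follows. *Propagation on $[t_{l-1},t_l]$:* $\dot G=Gf(G)$ and $$\dot P=JP+PJ^\top+S+\tfrac14\mathbb E\bigl(\operatorname{ad}_{\mathfrak g}(\epsilon)S\operatorname{ad}_{\mathfrak g}(\epsilon)^\top\bigr)+\tfrac1{12}\mathbb E\bigl(\operatorname{ad}_{\mathfrak g}(\epsilon)^2\bigr)S+\tfrac1{12}S\,\mathbb E\bigl(\operatorname{ad}_{\mathfrak g}(\epsilon)^2\bigr)^\top,$$ where $\epsilon\sim N(0,P(t))$, the matrix $P(t)$ being positive semidefinite, and $$J(t)=F(t)-\operatorname{ad}_{\mathfrak g}(\operatorname{vec}_{\mathfrak g}f(G(t)))+\tfrac1{12}C(S),\qquad F(t)=\mathbf d(\operatorname{vec}_{\mathfrak g}\circ f)(G(t)),\qquad C(S)=\sum_{i,j}S_{ij}\operatorname{ad}_{\mathfrak g}(e_i)\operatorname{ad}_{\mathfrak g}(e_j).$$ The values at $t_l$ are $G^-,P^-$. *Update:* with $H=\mathbf dh(G^-)$ set $K=P^-H^\top(HP^-H^\top+Q_l)^{-1}$,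 $m=K(z-h(G^-))$, $G(t_l)=G^-\operatorname{Exp}(\operatorname{mat}_{\mathfrak g}m)$ and $P(t_l)=\Phi(m)(\mathbb 1_{12}-KH)P^-\Phi(m)^\top$, where $\Phi(x)=\sum_{k\ge0}\frac{(-1)^k}{(k+1)!}\operatorname{ad}_{\mathfrak g}(x)^k$. **Proposition.** Consider the constant-acceleration model $f(E,v)=(\operatorname{mat}_{\mathfrak{se}}(v),0)$ with $n$ linear observations $y_k(t_l)=E(t_l)a_k+\varepsilon_k(t_l)\in\mathbb R^4$, $a_k\in\mathbb R^4$, which enter the filter through their sum, i.e. $h=\sum_k h_k$ with $h_k(E,v)=Ea_k$, $z=\sum_ky_k(t_l)$, and $Q_l\in\mathbb R^{4\times4}$ positive definite. Let $S$ be positive semidefinite. Then the CD-LG-EKF step is given by the following algorithm. - Integrate on $[t_{l-1},t_l]$ the equations $\dot E=E\operatorname{mat}_{\mathfrak{se}}(v)$, $\dot v=0$, and the equation for $\dot P$ above (again with $P(t)$ positive semidefinite); let $G^-=(E^-,v^-)$ and $P^-$ be the values at $t_l$. - $K_l=P^-H_l^\top(H_lP^-H_l^\top+Q_l)^{-1}$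 and $m=K_l\sum_{k=1}^n\bigl(y_k(t_l)-E^-a_k\bigr)$. - $E(t_l)=E^-\exp(\operatorname{mat}_{\mathfrak{se}}(m_{1:6}))$, $v(t_l)=v^-+m_{7:12}$ and $P(t_l)=\Phi(m)(\mathbb 1_{12}-K_lH_l)P^-\Phi(m)^\top$. That is, the same data (propagated state and covariance, gain, correction, updated state and covariance) satisfy the equations of the filter step if and only if they satisfy those of the algorithm. In the algorithm, the matrices are explicit: 1. $H_l=\sum_{k=1}^nH_l^k$, where $H_l^k\in\mathbb R^{4\times12}$ is the matrix whose $i$-th row is $\bigl(\operatorname{vec}_{\mathfrak{se}}(\operatorname{Pr}((E^-)^\top e_ia_k^\top))^\top,\ \mathbf 0_{1\times6}\bigr)$, $i=1,\dots,4$. Moreover $\mathbf dh_k(G^-)=H_l^k$. 2. $J(t)=F-\operatorname{ad}_{\mathfrak g}\bigl((v(t),0)\bigr)+\tfrac1{12}C(S)$ with $F=\begin{pmatrix}\mathbf 0&\mathbb 1_6\\\mathbf 0&\mathbf 0\end{pmatrix}$ and, for $x\in\mathbb R^{12}$, $$\operatorname{ad}_{\mathfrak g}(x)=\begin{pmatrix}\operatorname{ad}_{\mathfrak{se}}(x_{1:6})&\mathbf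 0\\\mathbf 0&\mathbf 0\end{pmatrix},\qquad\operatorname{ad}_{\mathfrak{se}}(u)=\begin{pmatrix}\operatorname{mat}_{\mathfrak{so}}(u_{1:3})&\mathbf 0\\\operatorname{mat}_{\mathfrak{so}}(u_{4:6})&\operatorname{mat}_{\mathfrak{so}}(u_{1:3})\end{pmatrix}.$$ If $S$ is diagonal, then $$C(S)=\begin{pmatrix}\begin{pmatrix}\Xi&\mathbf 0\\\mathbf 0&\Xi\end{pmatrix}&\mathbf 0\\\mathbf 0&\mathbf 0\end{pmatrix},\qquad\Xi=-\tfrac12\operatorname{diag}(S_{22}+S_{33},\,S_{11}+S_{33},\,S_{11}+S_{22}).$$ 3. $\Phi(x)=\begin{pmatrix}\Phi_{\operatorname{SE}_3}(x_{1:6})&\mathbf 0\\\mathbf 0&\mathbb 1_6\end{pmatrix}$ with $\Phi_{\operatorname{SE}_3}(u)=\sum_{k\ge0}\frac{(-1)^k}{(k+1)!}\operatorname{ad}_{\mathfrak{se}}(u)^k$. -/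

import Mathlib

attribute [local instance] LieRing.ofAssociativeRing

namespace LieEKF

open Matrix MeasureTheory ProbabilityTheory

/-! ## The group `SE₃` and its Lie algebra -/

/-- Coordinates of `ℝ⁶ = ℝ³ × ℝ³`: first the three rotational, then the three translational ones,
so that `x (.inl 0), x (.inl 1), x (.inl 2), x (.inr 0), x (.inr 1), x (.inr 2)` are
`x₁, …, x₆`. -/
abbrev I6 : Type := Fin 3 ⊕ Fin 3

/-- Coordinates of `ℝ¹² = ℝ⁶ × ℝ⁶`: first those of `se₃`, then those of the velocity. -/
abbrev I12 : Type := I6 ⊕ I6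

/-- The upper left `3 × 3` block of a `4 × 4` matrix. -/
def rotBlock (A : Matrix (Fin 4) (Fin 4) ℝ) : Matrix (Fin 3) (Fin 3) ℝ :=
  A.submatrix Fin.castSucc Fin.castSucc

lemma rotBlock_mul (A B : Matrix (Fin 4) (Fin 4) ℝ) (hB : B 3 = Pi.single 3 1) :
    rotBlock (A * B) = rotBlock A * rotBlock B := by
  ext i j
  have h0 : B 3 j.castSucc = 0 := by
    rw [hB, Pi.single_apply, if_neg]
    exact fun h => absurd h (Fin.castSucc_lt_last j).ne
  simp only [rotBlock, Matrix.submatrix_apply, Matrix.mul_apply]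
  rw [Fin.sum_univ_castSucc]
  have : (Fin.last 3 : Fin 4) = 3 := rfl
  rw [this, h0, mul_zero, add_zero]

lemma row_mul (A B : Matrix (Fin 4) (Fin 4) ℝ) (hA : A 3 = Pi.single 3 1) :
    (A * B) 3 = B 3 := by
  ext j
  simp [Matrix.mul_apply, hA, Pi.single_apply]

lemma rotBlock_one : rotBlock 1 = 1 := by
  ext i j
  simp [rotBlock, Matrix.one_apply]

lemma row_one : (1 : Matrix (Fin 4) (Fin 4) ℝ) 3 = Pi.single 3 1 := by
  ext j
  rw [Matrix.one_apply, Pi.single_apply]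
  simp only [eq_comm]

/-- `SE₃`: the invertible matrices `(R w; 0 1)` with `R ∈ SO₃`, `w ∈ ℝ³`. -/
def SE3 : Subgroup (GL (Fin 4) ℝ) where
  carrier := {E | rotBlock (E : Matrix (Fin 4) (Fin 4) ℝ) ∈ specialOrthogonalGroup (Fin 3) ℝ ∧
    (E : Matrix (Fin 4) (Fin 4) ℝ) 3 = Pi.single 3 1}
  mul_mem' := by
    rintro A B ⟨hA, hA'⟩ ⟨hB, hB'⟩
    refine ⟨?_, ?_⟩
    · rw [Units.val_mul, rotBlock_mul _ _ hB']
      exact mul_mem hA hB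
    · rw [Units.val_mul, row_mul _ _ hA', hB']
  one_mem' := by
    refine ⟨?_, ?_⟩
    · rw [Units.val_one, rotBlock_one]
      exact one_mem _
    · rw [Units.val_one, row_one]
  inv_mem' := by
    rintro A ⟨hA, hA'⟩
    have h1 : ((A⁻¹ : GL (Fin 4) ℝ) : Matrix (Fin 4) (Fin 4) ℝ) 3 = Pi.single 3 1 := by
      rw [← row_mul (A : Matrix (Fin 4) (Fin 4) ℝ)
        ((A⁻¹ : GL (Fin 4) ℝ) : Matrix (Fin 4) (Fin 4) ℝ) hA', ← Units.val_mul, mul_inv_cancel,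
        Units.val_one, row_one]
    refine ⟨?_, h1⟩
    have h2 := rotBlock_mul (A : Matrix (Fin 4) (Fin 4) ℝ) _ h1
    rw [← Units.val_mul, mul_inv_cancel, Units.val_one, rotBlock_one] at h2
    have h3 := (mem_specialOrthogonalGroup_iff.1 hA)
    have h4 := (mem_orthogonalGroup_iff' (Fin 3) ℝ).1 h3.1
    have h5 : rotBlock ((A⁻¹ : GL (Fin 4) ℝ) : Matrix (Fin 4) (Fin 4) ℝ) =
        star (rotBlock (A : Matrix (Fin 4) (Fin 4) ℝ)) := by
      calc _ = star (rotBlock (A : Matrix (Fin 4) (Fin 4) ℝ)) *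
              rotBlock (A : Matrix (Fin 4) (Fin 4) ℝ) *
              rotBlock ((A⁻¹ : GL (Fin 4) ℝ) : Matrix (Fin 4) (Fin 4) ℝ) := by
                rw [star_eq_conjTranspose, conjTranspose_eq_transpose_of_trivial, h4, one_mul]
        _ = _ := by rw [mul_assoc, ← h2, mul_one]
    rw [h5]
    exact (⟨_, hA⟩ : specialOrthogonalGroup (Fin 3) ℝ)⁻¹.2

/-- `se₃`: the matrices `(Ω w; 0 0)` with `Ω` skew-symmetric; the bracket is the commutator. -/
def se3 : LieSubalgebra ℝ (Matrix (Fin 4) (Fin 4) ℝ) where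
  carrier := {A | (rotBlock A)ᵀ = -rotBlock A ∧ A 3 = 0}
  add_mem' := by
    rintro A B ⟨hA, hA'⟩ ⟨hB, hB'⟩
    refine ⟨?_, by funext j; simp [hA', hB']⟩
    have : rotBlock (A + B) = rotBlock A + rotBlock B := rfl
    rw [this, transpose_add, hA, hB, neg_add]
  zero_mem' := ⟨by ext i j; simp [rotBlock], rfl⟩
  smul_mem' := by
    rintro c A ⟨hA, hA'⟩
    refine ⟨?_, by funext j; simp [hA']⟩
    have : rotBlock (c • A) = c • rotBlock A := rfl
    rw [this, transpose_smul, hA, smul_neg]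
  lie_mem' := by
    rintro A B ⟨hA, hA'⟩ ⟨hB, hB'⟩
    have key : ∀ A B : Matrix (Fin 4) (Fin 4) ℝ, B 3 = 0 →
        rotBlock (A * B) = rotBlock A * rotBlock B := by
      intro A B hB
      ext i j
      have h0 : B 3 j.castSucc = 0 := by rw [hB]; rfl
      simp only [rotBlock, Matrix.submatrix_apply, Matrix.mul_apply]
      rw [Fin.sum_univ_castSucc]
      have : (Fin.last 3 : Fin 4) = 3 := rfl
      rw [this, h0, mul_zero, add_zero]
    refine ⟨?_, ?_⟩
    · have h : rotBlock (A * B - B * A) =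
          rotBlock A * rotBlock B - rotBlock B * rotBlock A := by
        rw [← key A B hB', ← key B A hA']; rfl
      change (rotBlock (A * B - B * A))ᵀ = -rotBlock (A * B - B * A)
      rw [h, transpose_sub, transpose_mul, transpose_mul, hA, hB]
      simp
    · change (A * B - B * A) 3 = 0
      funext j
      simp [Matrix.mul_apply, hA', hB']

/-- The matrix `mat_so(w)`, with the normalising factor `1/√2`. -/
noncomputable def matSO (w : Fin 3 → ℝ) : Matrix (Fin 3) (Fin 3) ℝ :=
  !![0, -(w 2 / √2), w 1 / √2;
     w 2 / √2, 0, -(w 0 / √2);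
     -(w 1 / √2), w 0 / √2, 0]

/-- The linear isomorphism `vec_se : se₃ → ℝ⁶`; its inverse is
`mat_se(x) = (mat_so(x₁, x₂, x₃), (x₄, x₅, x₆)ᵀ; 0, 0)`. -/
noncomputable def vecSE : se3 ≃ₗ[ℝ] (I6 → ℝ) where
  toFun A := Sum.elim
    ![√2 * (A : Matrix (Fin 4) (Fin 4) ℝ) 2 1, √2 * (A : Matrix (Fin 4) (Fin 4) ℝ) 0 2,
      √2 * (A : Matrix (Fin 4) (Fin 4) ℝ) 1 0]
    ![(A : Matrix (Fin 4) (Fin 4) ℝ) 0 3, (A : Matrix (Fin 4) (Fin 4) ℝ) 1 3,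
      (A : Matrix (Fin 4) (Fin 4) ℝ) 2 3]
  map_add' A B := by
    ext (i | i) <;> fin_cases i <;> simp [mul_add]
  map_smul' c A := by
    ext (i | i) <;> fin_cases i <;> simp [mul_left_comm]
  invFun x := ⟨!![0, -(x (.inl 2) / √2), x (.inl 1) / √2, x (.inr 0);
      x (.inl 2) / √2, 0, -(x (.inl 0) / √2), x (.inr 1);
      -(x (.inl 1) / √2), x (.inl 0) / √2, 0, x (.inr 2);
      0, 0, 0, 0], by
    refine ⟨?_, ?_⟩
    · ext i j
      fin_cases i <;> fin_cases j <;> simp [rotBlock]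
    · ext j
      fin_cases j <;> simp⟩
  left_inv := by
    rintro ⟨A, hA, hA'⟩
    have h2 : √2 ≠ 0 := by positivity
    have h : ∀ i j : Fin 3, A j.castSucc i.castSucc = -A i.castSucc j.castSucc :=
      fun i j => congrFun (congrFun hA i) j
    have h00 := h 0 0
    have h01 := h 0 1
    have h02 := h 0 2
    have h11 := h 1 1
    have h12 := h 1 2
    have h22 := h 2 2
    have h3 : ∀ j, A 3 j = 0 := fun j => congrFun hA' j
    simp at h00 h01 h02 h11 h12 h22
    ext i j
    fin_cases i <;> fin_cases j <;>
      simp [h2, h3] <;> linarith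
  right_inv x := by
    have h2 : √2 ≠ 0 := by positivity
    ext (i | i) <;> fin_cases i <;> simp <;> field_simp

/-- `mat_se = vec_se⁻¹`. -/
noncomputable abbrev matSE (x : I6 → ℝ) : se3 := vecSE.symm x

/-- The projection `Pr : ℝ^{4×4} → se₃`. -/
noncomputable def prSE (A : Matrix (Fin 4) (Fin 4) ℝ) : se3 :=
  ⟨(1 / 2 : ℝ) • (diagonal ![1, 1, 1, 0] *
      (A * diagonal ![1, 1, 1, 2] - Aᵀ * diagonal ![1, 1, 1, 0])), by
    refine ⟨?_, ?_⟩
    · ext i j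
      fin_cases i <;> fin_cases j <;> simp [rotBlock, Matrix.diagonal_mul, Matrix.mul_diagonal] <;>
        ring
    · ext j
      simp [Matrix.diagonal_mul]⟩

/-! ## The exponential map of `SE₃` -/

lemma det_rotBlock (A : Matrix (Fin 4) (Fin 4) ℝ) (hA : A 3 = Pi.single 3 1) :
    (rotBlock A).det = A.det := by
  have h3 : ∀ j, A 3 j = (Pi.single 3 1 : Fin 4 → ℝ) j := fun j => congrFun hA j
  rw [Matrix.det_succ_row A 3, Fin.sum_univ_four]
  simp only [h3]
  simp [rotBlock]
  rw [Even.neg_one_pow (by decide), one_mul]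
  congr 1
  ext i j
  fin_cases i <;> fin_cases j <;> rfl

section
attribute [local instance] Matrix.linftyOpNormedRing Matrix.linftyOpNormedAlgebra

lemma exp_semiconj {x a b : Matrix (Fin 4) (Fin 4) ℝ} (h : x * a = b * x) :
    x * NormedSpace.exp a = NormedSpace.exp b * x :=
  SemiconjBy.exp_right h
end

lemma exp_row (A : Matrix (Fin 4) (Fin 4) ℝ) (hA : A 3 = 0) :
    (NormedSpace.exp A) 3 = Pi.single 3 1 := by
  have h : Matrix.single (3 : Fin 4) (3 : Fin 4) (1 : ℝ) * A =
      0 * Matrix.single (3 : Fin 4) (3 : Fin 4) (1 : ℝ) := by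
    ext i j
    by_cases hi : 3 = i
    · subst hi
      simp [hA]
    · rw [Matrix.single_mul_apply_of_ne (h := Ne.symm hi)]
      simp
  have h' := exp_semiconj h
  rw [NormedSpace.exp_zero, one_mul] at h'
  ext j
  have := congrFun (congrFun h' 3) j
  rw [Matrix.single_mul_apply_same, one_mul] at this
  rw [this, Matrix.single_apply, Pi.single_apply]
  simp [eq_comm]

lemma exp_det_isUnit (A : Matrix (Fin 4) (Fin 4) ℝ) : IsUnit (NormedSpace.exp A).det := by
  have h := Matrix.isUnit_exp A
  rwa [Matrix.isUnit_iff_isUnit_det] at h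

lemma exp_det_pos (A : Matrix (Fin 4) (Fin 4) ℝ) : 0 < (NormedSpace.exp A).det := by
  have h : NormedSpace.exp A =
      NormedSpace.exp ((1 / 2 : ℝ) • A) * NormedSpace.exp ((1 / 2 : ℝ) • A) := by
    rw [← Matrix.exp_add_of_commute _ _ (Commute.refl _), ← add_smul]
    norm_num
  have hu : (NormedSpace.exp ((1 / 2 : ℝ) • A)).det ≠ 0 :=
    (exp_det_isUnit ((1 / 2 : ℝ) • A)).ne_zero
  rw [h, det_mul]
  exact mul_self_pos.2 hu

lemma exp_mem (A : se3) :
    (Matrix.isUnit_exp (A : Matrix (Fin 4) (Fin 4) ℝ)).unit ∈ SE3 := by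
  obtain ⟨A, hA, hA'⟩ := A
  have hrow := exp_row A hA'
  have h3 : ∀ j, A 3 j = 0 := fun j => congrFun hA' j
  have h : ∀ i j : Fin 3, A j.castSucc i.castSucc = -A i.castSucc j.castSucc :=
    fun i j => congrFun (congrFun hA i) j
  have h00 := h 0 0
  have h01 := h 0 1
  have h02 := h 0 2
  have h11 := h 1 1
  have h12 := h 1 2
  have h22 := h 2 2
  simp at h00 h01 h02 h11 h12 h22
  set D : Matrix (Fin 4) (Fin 4) ℝ := diagonal ![1, 1, 1, 0] with hD
  have hs : D * (-Aᵀ) = A * D := by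
    ext i j
    fin_cases i <;> fin_cases j <;>
      simp [hD, Matrix.diagonal_mul, Matrix.mul_diagonal, h3] <;> linarith
  have h' := exp_semiconj hs
  rw [Matrix.exp_neg, Matrix.exp_transpose] at h'
  have hu : IsUnit ((NormedSpace.exp A)ᵀ).det := by
    rw [det_transpose]
    exact exp_det_isUnit A
  have h2 : D = NormedSpace.exp A * D * (NormedSpace.exp A)ᵀ := by
    rw [← h', Matrix.mul_assoc, Matrix.nonsing_inv_mul _ hu, Matrix.mul_one]
  have horth : rotBlock (NormedSpace.exp A) * (rotBlock (NormedSpace.exp A))ᵀ = 1 := by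
    ext i j
    have h4 := congrFun (congrFun h2 i.castSucc) j.castSucc
    rw [Matrix.mul_apply, Fin.sum_univ_castSucc] at h4
    simp only [hD, Matrix.mul_diagonal, Matrix.transpose_apply] at h4
    rw [Matrix.mul_apply]
    have e : ∀ k : Fin 3, (![1, 1, 1, 0] : Fin 4 → ℝ) k.castSucc = 1 := by
      intro k; fin_cases k <;> rfl
    have e' : (![1, 1, 1, 0] : Fin 4 → ℝ) (Fin.last 3) = 0 := rfl
    simp only [e, e', mul_one, mul_zero, zero_mul, add_zero] at h4
    simp only [rotBlock, Matrix.submatrix_apply, Matrix.transpose_apply]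
    rw [← h4, Matrix.diagonal_apply, Matrix.one_apply]
    simp [e]
  refine ⟨?_, hrow⟩
  change rotBlock (NormedSpace.exp A) ∈ _
  rw [mem_specialOrthogonalGroup_iff]
  refine ⟨(mem_orthogonalGroup_iff (Fin 3) ℝ).2 horth, ?_⟩
  have hpos : 0 < (rotBlock (NormedSpace.exp A)).det := by
    rw [det_rotBlock _ hrow]
    exact exp_det_pos A
  have hsq := congrArg Matrix.det horth
  rw [det_mul, det_transpose, det_one] at hsq
  nlinarith

/-- `Exp_{SE₃} : se₃ → SE₃`, the matrix exponential. -/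
noncomputable def expSE (A : se3) : SE3 := ⟨_, exp_mem A⟩

/-! ## The product group `𝒢 = SE₃ × ℝ⁶` -/

/-- The Lie group `𝒢 = SE₃ × ℝ⁶`, with `(E₁, v₁) (E₂, v₂) = (E₁ E₂, v₁ + v₂)`. -/
abbrev StateGroup : Type := SE3 × Multiplicative (I6 → ℝ)

/-- The Lie algebra `𝔤 = se₃ × ℝ⁶` of `𝒢`, with componentwise bracket (zero on `ℝ⁶`). -/
abbrev StateAlgebra : Type := se3 × (I6 → ℝ)

/-- The first component `E` of `G = (E, v)`, as a matrix. -/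
def pose (G : StateGroup) : Matrix (Fin 4) (Fin 4) ℝ := ((G.1 : GL (Fin 4) ℝ) : Matrix _ _ ℝ)

/-- The second component `v` of `G = (E, v)`. -/
def velocity (G : StateGroup) : I6 → ℝ := G.2.toAdd

/-- `vec_𝔤 : 𝔤 → ℝ¹²`, `(η₁, η₂) ↦ (vec_se η₁, η₂)`. -/
noncomputable def vecG : StateAlgebra ≃ₗ[ℝ] (I12 → ℝ) :=
  (vecSE.prodCongr (LinearEquiv.refl ℝ (I6 → ℝ))).trans
    (LinearEquiv.sumArrowLequivProdArrow I6 I6 ℝ ℝ).symm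

/-- `mat_𝔤 = vec_𝔤⁻¹`. -/
noncomputable abbrev matG (x : I12 → ℝ) : StateAlgebra := vecG.symm x

/-- The basis of `𝔤` whose coordinates are `vec_𝔤`. -/
noncomputable def basisG : Module.Basis I12 ℝ StateAlgebra := Module.Basis.ofEquivFun vecG

/-- `Exp_𝒢 (η₁, η₂) = (Exp_{SE₃} η₁, η₂)`. -/
noncomputable def expG (η : StateAlgebra) : StateGroup := (expSE η.1, Multiplicative.ofAdd η.2)

/-- The curve `γ` in `𝒢` satisfies `γ̇(t) = γ(t) ξ` within `s`, where
`G ξ = T_{Id} L_G ξ = (E ξ₁, ξ₂)` for `G = (E, v)`. -/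
def HasLeftVelocityWithinAt (γ : ℝ → StateGroup) (ξ : StateAlgebra) (s : Set ℝ) (t : ℝ) : Prop :=
  HasDerivWithinAt (fun τ => pose (γ τ)) (pose (γ t) * (ξ.1 : Matrix (Fin 4) (Fin 4) ℝ)) s t ∧
  HasDerivWithinAt (fun τ => velocity (γ τ)) ξ.2 s t

/-! ## Ingredients of the extended Kalman filter on a Lie group -/

section General

variable {ι κ L : Type*} [Fintype ι] [DecidableEq ι] [Fintype κ] [LieRing L] [LieAlgebra ℝ L]

/-- The matrix of `ad(x)` in the basis `b`, for `x` given by its coordinates. -/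
noncomputable def adMatrix (b : Module.Basis ι ℝ L) (x : ι → ℝ) : Matrix ι ι ℝ :=
  LinearMap.toMatrix b b (LieAlgebra.ad ℝ L (b.equivFun.symm x))

/-- `C(S) = ∑ᵢⱼ Sᵢⱼ ad(bᵢ) ad(bⱼ) = 𝔼(ad(δ)²)` for noise `δ` with covariance `S`; the Itô
correction of the drift of the left-invariant error is `C(S)/12` to first order. -/
noncomputable def itoMatrix (b : Module.Basis ι ℝ L) (S : Matrix ι ι ℝ) : Matrix ι ι ℝ :=
  ∑ i, ∑ j, S i j • (adMatrix b (Pi.single i 1) * adMatrix b (Pi.single j 1))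

/-- `Φ(x) = ∑_{k ≥ 0} (-1)ᵏ / (k+1)! ad(x)ᵏ`, so that
`Log(Exp(-x) Exp(x + y)) = Φ(x) y + O(‖y‖²)`. -/
noncomputable def phiMatrix (b : Module.Basis ι ℝ L) (x : ι → ℝ) : Matrix ι ι ℝ :=
  ∑' k : ℕ, ((-1 : ℝ) ^ k / ((k + 1).factorial : ℝ)) • adMatrix b x ^ k

/-- The entrywise expectation `𝔼 (M(ε))` for a Gaussian vector `ε ∼ N(0, P)`. -/
noncomputable def gaussianMean (P : Matrix ι ι ℝ) (M : (ι → ℝ) → Matrix ι ι ℝ) : Matrix ι ι ℝ :=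
  Matrix.of fun i j => ∫ ε, M ε.ofLp i j ∂(multivariateGaussian 0 P)

end General

/-- `D` is the matrix of the differential of `φ : 𝒢 → ℝ^κ` at `G`, left-trivialised and in the
coordinates `vec_𝔤`: the derivative of `x ↦ φ(G Exp(mat_𝔤 x))` at `x = 0`. -/
def HasLeftJacobian {κ : Type*} [Fintype κ] (φ : StateGroup → κ → ℝ) (G : StateGroup)
    (D : Matrix κ I12 ℝ) : Prop :=
  HasFDerivAt (fun x : I12 → ℝ => φ (G * expG (matG x)))
    (LinearMap.toContinuousLinearMap D.mulVecLin) 0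

/-- The matrix of the left-trivialised differential of `φ` at `G`. -/
noncomputable def leftJacobian {κ : Type*} [Fintype κ] (φ : StateGroup → κ → ℝ)
    (G : StateGroup) : Matrix κ I12 ℝ :=
  LinearMap.toMatrix'
    (fderiv ℝ (fun x : I12 → ℝ => φ (G * expG (matG x))) 0).toLinearMap

/-- `J = F - ad_𝔤(f(G)) + C(S)/12` with `F = d f(G)`, for an arbitrary drift `f`. -/
noncomputable def driftJacobian (f : StateGroup → StateAlgebra) (S : Matrix I12 I12 ℝ)
    (G : StateGroup) : Matrix I12 I12 ℝ :=
  leftJacobian (fun H => vecG (f H)) G - adMatrix basisG (vecG (f G)) +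
    (1 / 12 : ℝ) • itoMatrix basisG S

/-- One step, from `t₀` to `t₁`, of the continuous-discrete extended Kalman filter on `𝒢` for
`Ġ = G (f(G) + δ)`, with white noise `δ` of covariance `S` (in the coordinates `vec_𝔤`), and the
observation `z = h(G(t₁)) + ε`, with `ε` of covariance `Q`. It starts from the estimate `G₀` with
error covariance `P₀` and returns `G₁, P₁`; `Gc, Pc` are the propagated state and covariance on
`[t₀, t₁]`, `K` the gain and `m` the correction. -/
structure IsEKFStep {κ : Type*} [Fintype κ] [DecidableEq κ]
    (f : StateGroup → StateAlgebra) (h : StateGroup → κ → ℝ)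
    (S : Matrix I12 I12 ℝ) (Q : Matrix κ κ ℝ) (t₀ t₁ : ℝ) (z : κ → ℝ)
    (G₀ : StateGroup) (P₀ : Matrix I12 I12 ℝ)
    (Gc : ℝ → StateGroup) (Pc : ℝ → Matrix I12 I12 ℝ)
    (K : Matrix I12 κ ℝ) (m : I12 → ℝ)
    (G₁ : StateGroup) (P₁ : Matrix I12 I12 ℝ) : Prop where
  state_init : Gc t₀ = G₀
  cov_init : Pc t₀ = P₀
  state_ode : ∀ t ∈ Set.Icc t₀ t₁, HasLeftVelocityWithinAt Gc (f (Gc t)) (Set.Icc t₀ t₁) t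
  cov_posSemidef : ∀ t ∈ Set.Icc t₀ t₁, (Pc t).PosSemidef
  cov_ode : ∀ t ∈ Set.Icc t₀ t₁, HasDerivWithinAt Pc
    (driftJacobian f S (Gc t) * Pc t + Pc t * (driftJacobian f S (Gc t))ᵀ + S
      + (1 / 4 : ℝ) • gaussianMean (Pc t)
          (fun ε => adMatrix basisG ε * S * (adMatrix basisG ε)ᵀ)
      + (1 / 12 : ℝ) • (gaussianMean (Pc t) (fun ε => adMatrix basisG ε ^ 2) * S)
      + (1 / 12 : ℝ) • (S * (gaussianMean (Pc t) (fun ε => adMatrix basisG ε ^ 2))ᵀ))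
    (Set.Icc t₀ t₁) t
  gain : K = Pc t₁ * (leftJacobian h (Gc t₁))ᵀ *
    (leftJacobian h (Gc t₁) * Pc t₁ * (leftJacobian h (Gc t₁))ᵀ + Q)⁻¹
  correction : m = K *ᵥ (z - h (Gc t₁))
  state_update : G₁ = Gc t₁ * expG (matG m)
  cov_update : P₁ = phiMatrix basisG m * (1 - K * leftJacobian h (Gc t₁)) * Pc t₁ *
    (phiMatrix basisG m)ᵀ

/-! ## The constant acceleration model with linear observations -/

/-- The drift `f((E, v)) = (mat_se(v), 0)` of the constant acceleration model. -/
noncomputable def constAccDrift (G : StateGroup) : StateAlgebra := (matSE (velocity G), 0)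

/-- The linear observation `h((E, v)) = E a`. -/
def linearObs (a : Fin 4 → ℝ) (G : StateGroup) : Fin 4 → ℝ := pose G *ᵥ a

/-! ## The explicit algorithm -/

/-- The explicit adjoint matrix `ad_se^vec(v)`. -/
noncomputable def adSEvec (v : I6 → ℝ) : Matrix I6 I6 ℝ :=
  fromBlocks (matSO (v ∘ .inl)) 0 (matSO (v ∘ .inr)) (matSO (v ∘ .inl))

/-- The explicit adjoint matrix `ad_𝔤^vec(v)`. -/
noncomputable def adGvec (v : I12 → ℝ) : Matrix I12 I12 ℝ :=
  fromBlocks (adSEvec (v ∘ .inl)) 0 0 0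

/-- The explicit matrix `F = (0, 1₆; 0, 0)`. -/
def explicitF : Matrix I12 I12 ℝ := fromBlocks 0 1 0 0

/-- The explicit matrix `J = F - ad_𝔤(f(G)) + C/12`, where `vec_𝔤 (f(G)) = (v, 0)` for
`G = (E, v)`. -/
noncomputable def explicitJ (C : Matrix I12 I12 ℝ) (v : I6 → ℝ) : Matrix I12 I12 ℝ :=
  explicitF - adGvec (Sum.elim v 0) + (1 / 12 : ℝ) • C

/-- The explicit `3 × 3` matrix `Ξ`, for `S` with the diagonal `s`. -/
noncomputable def explicitXi (s : I12 → ℝ) : Matrix (Fin 3) (Fin 3) ℝ :=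
  -((1 / 2 : ℝ) • diagonal ![s (.inl (.inl 1)) + s (.inl (.inl 2)),
    s (.inl (.inl 0)) + s (.inl (.inl 2)), s (.inl (.inl 0)) + s (.inl (.inl 1))])

/-- The explicit matrix `C(S)`, for the diagonal matrix `S` with the diagonal `s`. -/
noncomputable def explicitC (s : I12 → ℝ) : Matrix I12 I12 ℝ :=
  fromBlocks (fromBlocks (explicitXi s) 0 0 (explicitXi s)) 0 0 0

/-- The explicit matrix `Hᵏ ∈ ℝ^{4×12}`: its row `i` is `(vec_se(Pr(Eᵀ eᵢ aᵀ))ᵀ, 0)`. -/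
noncomputable def explicitHk (a : Fin 4 → ℝ) (E : Matrix (Fin 4) (Fin 4) ℝ) :
    Matrix (Fin 4) I12 ℝ :=
  Matrix.of fun i => Sum.elim (vecSE (prSE (Eᵀ * vecMulVec (Pi.single i 1) a))) 0

/-- The explicit observation matrix `H = ∑ₖ Hᵏ`. -/
noncomputable def explicitH {n : ℕ} (a : Fin n → Fin 4 → ℝ) (E : Matrix (Fin 4) (Fin 4) ℝ) :
    Matrix (Fin 4) I12 ℝ :=
  ∑ k, explicitHk (a k) E

/-- `Φ_{SE₃}(v) = ∑_{k ≥ 0} (-1)ᵏ / (k+1)! ad_se^vec(v)ᵏ`. -/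
noncomputable def phiSE (v : I6 → ℝ) : Matrix I6 I6 ℝ :=
  ∑' k : ℕ, ((-1 : ℝ) ^ k / ((k + 1).factorial : ℝ)) • adSEvec v ^ k

/-- The block matrix `Φ(v) = (Φ_{SE₃}(v_{1:6}), 0; 0, 1₆)`. -/
noncomputable def explicitPhi (v : I12 → ℝ) : Matrix I12 I12 ℝ :=
  fromBlocks (phiSE (v ∘ .inl)) 0 0 1

/-- One pass of the explicit algorithm, from `t₀` to `t₁`, with the observations
`y₁, …, yₙ ∈ ℝ⁴` at `t₁`. The matrix `C` is the one that enters `J`. -/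
structure IsAlgorithmStep {n : ℕ} (a : Fin n → Fin 4 → ℝ) (C : Matrix I12 I12 ℝ)
    (S : Matrix I12 I12 ℝ) (Q : Matrix (Fin 4) (Fin 4) ℝ) (t₀ t₁ : ℝ) (y : Fin n → Fin 4 → ℝ)
    (G₀ : StateGroup) (P₀ : Matrix I12 I12 ℝ)
    (Gc : ℝ → StateGroup) (Pc : ℝ → Matrix I12 I12 ℝ)
    (K : Matrix I12 (Fin 4) ℝ) (m : I12 → ℝ)
    (G₁ : StateGroup) (P₁ : Matrix I12 I12 ℝ) : Prop where
  state_init : Gc t₀ = G₀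
  cov_init : Pc t₀ = P₀
  pose_ode : ∀ t ∈ Set.Icc t₀ t₁, HasDerivWithinAt (fun τ => pose (Gc τ))
    (pose (Gc t) * (matSE (velocity (Gc t)) : Matrix (Fin 4) (Fin 4) ℝ)) (Set.Icc t₀ t₁) t
  velocity_ode : ∀ t ∈ Set.Icc t₀ t₁,
    HasDerivWithinAt (fun τ => velocity (Gc τ)) 0 (Set.Icc t₀ t₁) t
  cov_posSemidef : ∀ t ∈ Set.Icc t₀ t₁, (Pc t).PosSemidef
  cov_ode : ∀ t ∈ Set.Icc t₀ t₁, HasDerivWithinAt Pc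
    (explicitJ C (velocity (Gc t)) * Pc t + Pc t * (explicitJ C (velocity (Gc t)))ᵀ + S
      + (1 / 4 : ℝ) • gaussianMean (Pc t) (fun ε => adGvec ε * S * (adGvec ε)ᵀ)
      + (1 / 12 : ℝ) • (gaussianMean (Pc t) (fun ε => adGvec ε ^ 2) * S)
      + (1 / 12 : ℝ) • (S * (gaussianMean (Pc t) (fun ε => adGvec ε ^ 2))ᵀ))
    (Set.Icc t₀ t₁) t
  gain : K = Pc t₁ * (explicitH a (pose (Gc t₁)))ᵀ *
    (explicitH a (pose (Gc t₁)) * Pc t₁ * (explicitH a (pose (Gc t₁)))ᵀ + Q)⁻¹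
  correction : m = K *ᵥ ∑ k, (y k - pose (Gc t₁) *ᵥ a k)
  pose_update : pose G₁ = pose (Gc t₁) *
    NormedSpace.exp (matSE (m ∘ .inl) : Matrix (Fin 4) (Fin 4) ℝ)
  velocity_update : velocity G₁ = velocity (Gc t₁) + m ∘ .inr
  cov_update : P₁ = explicitPhi m * (1 - K * explicitH a (pose (Gc t₁))) * Pc t₁ *
    (explicitPhi m)ᵀ

end LieEKF

open LieEKF

/-!
`𝒢` is the product of `SE₃` with an abelian group. For a product of Lie algebras the matrices
`ad`, `C(S)` and `Φ` are block diagonal, and an abelian factor contributes the blocks `0`, `0` and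
`1`, so only the `se₃` blocks have to be computed.

The left-trivialised derivative of `(E, v) ↦ E a` is `x ↦ E mat_se(x₁, …, x₆) a`. Its `i`-th
component is the Frobenius product of `Eᵀ eᵢ aᵀ` with `mat_se(x₁, …, x₆)`, and as `Pr` is the
orthogonal projection onto `se₃` and `vec_se` is an isometry, it equals
`⟨vec_se(Pr(Eᵀ eᵢ aᵀ)), (x₁, …, x₆)⟩`.
-/

namespace LieEKF

open Matrix

section AdjointMatrix

lemma basis_prod_equivFun_symm {ι κ R M N : Type*} [Finite ι] [Finite κ] [Semiring R]
    [AddCommMonoid M] [Module R M] [AddCommMonoid N] [Module R N]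
    (b : Module.Basis ι R M) (c : Module.Basis κ R N) (x : ι ⊕ κ → R) :
    (b.prod c).equivFun.symm x = (b.equivFun.symm (x ∘ .inl), c.equivFun.symm (x ∘ .inr)) := by
  rw [LinearEquiv.symm_apply_eq]
  ext (i | i)
  · exact (congrFun (b.equivFun.apply_symm_apply (x ∘ .inl)) i).symm
  · exact (congrFun (c.equivFun.apply_symm_apply (x ∘ .inr)) i).symm

variable {ι κ L M : Type*} [Fintype ι] [Fintype κ] [LieRing L] [LieAlgebra ℝ L]
  [LieRing M] [LieAlgebra ℝ M] [DecidableEq ι] [DecidableEq κ]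

lemma adMatrix_apply (b : Module.Basis ι ℝ L) (x : ι → ℝ) (i j : ι) :
    adMatrix b x i j = b.repr ⁅b.equivFun.symm x, b j⁆ i :=
  LinearMap.toMatrix_apply b b _ i j

lemma adMatrix_zero (b : Module.Basis ι ℝ L) : adMatrix b 0 = 0 := by
  rw [adMatrix, map_zero, map_zero, map_zero]

lemma adMatrix_prod (b : Module.Basis ι ℝ L) (c : Module.Basis κ ℝ M) (x : ι ⊕ κ → ℝ) :
    adMatrix (b.prod c) x =
      fromBlocks (adMatrix b (x ∘ .inl)) 0 0 (adMatrix c (x ∘ .inr)) := by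
  ext (i | i) (j | j) <;>
    simp [adMatrix_apply, basis_prod_equivFun_symm, LieAlgebra.Prod.bracket_apply,
      -Module.Basis.equivFun_symm_apply]

lemma adMatrix_eq_zero [IsLieAbelian L] (b : Module.Basis ι ℝ L) (x : ι → ℝ) :
    adMatrix b x = 0 := by
  ext i j
  rw [adMatrix_apply, trivial_lie_zero, map_zero, Finsupp.zero_apply, Matrix.zero_apply]

lemma itoMatrix_prod (b : Module.Basis ι ℝ L) (c : Module.Basis κ ℝ M)
    (S : Matrix (ι ⊕ κ) (ι ⊕ κ) ℝ) :
    itoMatrix (b.prod c) S =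
      fromBlocks (itoMatrix b S.toBlocks₁₁) 0 0 (itoMatrix c S.toBlocks₂₂) := by
  have hl (i : ι) : adMatrix (b.prod c) (Pi.single (.inl i) 1) =
      fromBlocks (adMatrix b (Pi.single i 1)) 0 0 0 := by
    rw [adMatrix_prod, ← Sum.elim_single_zero, Sum.elim_comp_inl, Sum.elim_comp_inr, adMatrix_zero]
  have hr (j : κ) : adMatrix (b.prod c) (Pi.single (.inr j) 1) =
      fromBlocks 0 0 0 (adMatrix c (Pi.single j 1)) := by
    rw [adMatrix_prod, ← Sum.elim_zero_single, Sum.elim_comp_inl, Sum.elim_comp_inr, adMatrix_zero]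
  ext (i | i) (j | j) <;>
    simp [itoMatrix, Fintype.sum_sum_type, hl, hr, fromBlocks_multiply, Matrix.sum_apply,
      toBlocks₁₁, toBlocks₂₂]

lemma itoMatrix_eq_zero [IsLieAbelian L] (b : Module.Basis ι ℝ L) (S : Matrix ι ι ℝ) :
    itoMatrix b S = 0 := by
  simp only [itoMatrix, adMatrix_eq_zero, mul_zero, smul_zero, Finset.sum_const_zero]

lemma itoMatrix_diagonal (b : Module.Basis ι ℝ L) (s : ι → ℝ) :
    itoMatrix b (diagonal s) = ∑ i, s i • adMatrix b (Pi.single i 1) ^ 2 := by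
  simp [itoMatrix, diagonal_apply, ite_smul, pow_two]

lemma summable_phiSeries {𝔸 : Type*} [NormedRing 𝔸] [NormedAlgebra ℝ 𝔸] [CompleteSpace 𝔸]
    (a : 𝔸) : Summable fun k : ℕ => ((-1 : ℝ) ^ k / ((k + 1).factorial : ℝ)) • a ^ k := by
  refine .of_norm_bounded (NormedSpace.norm_expSeries_summable' (𝕂 := ℝ) a) fun k => ?_
  rw [norm_smul, norm_smul, norm_div, norm_pow, norm_neg, norm_one, one_pow, one_div, norm_inv,
    RCLike.norm_natCast, RCLike.norm_natCast]
  gcongr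
  exact k.le_succ

section
attribute [local instance] Matrix.linftyOpNormedRing Matrix.linftyOpNormedAlgebra

lemma hasSum_phiMatrix (b : Module.Basis ι ℝ L) (x : ι → ℝ) :
    HasSum (fun k : ℕ => ((-1 : ℝ) ^ k / ((k + 1).factorial : ℝ)) • adMatrix b x ^ k)
      (phiMatrix b x) :=
  (summable_phiSeries (adMatrix b x)).hasSum

end

lemma hasSum_fromBlocks {m n o p β R : Type*} [AddCommMonoid R] [TopologicalSpace R]
    {f : β → Matrix m o R} {g : β → Matrix m p R} {h : β → Matrix n o R} {k : β → Matrix n p R}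
    {A : Matrix m o R} {B : Matrix m p R} {C : Matrix n o R} {D : Matrix n p R}
    (hf : HasSum f A) (hg : HasSum g B) (hh : HasSum h C) (hk : HasSum k D) :
    HasSum (fun i => fromBlocks (f i) (g i) (h i) (k i)) (fromBlocks A B C D) := by
  refine Pi.hasSum.2 fun i => Pi.hasSum.2 fun j => ?_
  rcases i with i | i <;> rcases j with j | j
  exacts [Pi.hasSum.1 (Pi.hasSum.1 hf i) j, Pi.hasSum.1 (Pi.hasSum.1 hg i) j,
    Pi.hasSum.1 (Pi.hasSum.1 hh i) j, Pi.hasSum.1 (Pi.hasSum.1 hk i) j]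

lemma phiMatrix_prod (b : Module.Basis ι ℝ L) (c : Module.Basis κ ℝ M) (x : ι ⊕ κ → ℝ) :
    phiMatrix (b.prod c) x =
      fromBlocks (phiMatrix b (x ∘ .inl)) 0 0 (phiMatrix c (x ∘ .inr)) := by
  refine HasSum.tsum_eq ?_
  simpa only [adMatrix_prod, fromBlocks_diagonal_pow, fromBlocks_smul, smul_zero] using
    hasSum_fromBlocks (hasSum_phiMatrix b (x ∘ .inl)) hasSum_zero hasSum_zero
      (hasSum_phiMatrix c (x ∘ .inr))

lemma phiMatrix_eq_one [IsLieAbelian L] (b : Module.Basis ι ℝ L) (x : ι → ℝ) :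
    phiMatrix b x = 1 := by
  rw [phiMatrix, tsum_eq_single 0]
  · simp
  · intro k hk
    rw [adMatrix_eq_zero, zero_pow hk, smul_zero]

end AdjointMatrix

section SO3

lemma matSO_zero : matSO 0 = 0 := by
  ext i j
  fin_cases i <;> fin_cases j <;> simp [matSO]

lemma matSO_mulVec (u v : Fin 3 → ℝ) : matSO u *ᵥ v = (√2)⁻¹ • (u ⨯₃ v) := by
  ext i
  fin_cases i <;> simp [matSO, cross_apply, vecHead, vecTail] <;> ring

lemma matSO_mulVec_anticomm (u v : Fin 3 → ℝ) : -(matSO u *ᵥ v) = matSO v *ᵥ u := by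
  rw [matSO_mulVec, matSO_mulVec, ← smul_neg, cross_anticomm]

lemma matSO_mul_sub_mul (u v : Fin 3 → ℝ) :
    matSO u * matSO v - matSO v * matSO u = matSO (matSO u *ᵥ v) := by
  refine mulVec_injective (funext fun w => ?_)
  simp only [sub_mulVec, ← mulVec_mulVec, matSO_mulVec, map_smul, LinearMap.smul_apply]
  rw [leibniz_cross u v w, smul_add, smul_add, add_sub_cancel_right]

lemma matSO_sq (w : Fin 3 → ℝ) :
    matSO w ^ 2 = (1 / 2 : ℝ) • (vecMulVec w w - (w ⬝ᵥ w) • (1 : Matrix (Fin 3) (Fin 3) ℝ)) := by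
  refine mulVec_injective (funext fun v => ?_)
  simp only [pow_two, ← mulVec_mulVec, matSO_mulVec, map_smul, cross_cross_eq_smul_sub_smul',
    smul_mulVec, sub_mulVec, vecMulVec_mulVec, one_mulVec, op_smul_eq_smul, smul_smul]
  rw [← mul_inv, Real.mul_self_sqrt zero_le_two, one_div]

lemma sum_smul_matSO_single_sq (s : I12 → ℝ) :
    ∑ i, s (.inl (.inl i)) • matSO (Pi.single i 1) ^ 2 = explicitXi s := by
  ext i j
  fin_cases i <;> fin_cases j <;>
    simp [explicitXi, matSO_sq, Fin.sum_univ_three, vecMulVec_apply] <;> ring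

end SO3

section SE3Coordinates

/-- The basis of `se₃` whose coordinates are `vec_se`. -/
noncomputable def basisSE : Module.Basis I6 ℝ se3 := Module.Basis.ofEquivFun vecSE

lemma basisG_eq_prod : basisG = basisSE.prod (Pi.basisFun ℝ I6) := by
  refine Module.Basis.repr_injective ?_
  ext η (i | i) <;> rfl

lemma coe_matSE (x : I6 → ℝ) : (matSE x : Matrix (Fin 4) (Fin 4) ℝ) =
    !![0, -(x (.inl 2) / √2), x (.inl 1) / √2, x (.inr 0);
      x (.inl 2) / √2, 0, -(x (.inl 0) / √2), x (.inr 1);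
      -(x (.inl 1) / √2), x (.inl 0) / √2, 0, x (.inr 2);
      0, 0, 0, 0] := rfl

lemma coe_matSE_eq_submatrix_fromBlocks (x : I6 → ℝ) :
    (matSE x : Matrix (Fin 4) (Fin 4) ℝ) =
      (fromBlocks (matSO (x ∘ .inl)) (replicateCol (Fin 1) (x ∘ .inr)) 0 0).submatrix
        (finSumFinEquiv (m := 3) (n := 1)).symm (finSumFinEquiv (m := 3) (n := 1)).symm := by
  ext i j
  fin_cases i <;> fin_cases j <;> rfl

lemma lie_matSE (x y : I6 → ℝ) : ⁅matSE x, matSE y⁆ = matSE (adSEvec x *ᵥ y) := by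
  refine Subtype.ext ?_
  rw [LieSubalgebra.coe_bracket, LieRing.of_associative_ring_bracket]
  simp only [coe_matSE_eq_submatrix_fromBlocks, submatrix_mul_equiv, fromBlocks_multiply,
    Matrix.zero_mul, mul_zero, add_zero, adSEvec, fromBlocks_mulVec, zero_mulVec, Sum.elim_comp_inl,
    Sum.elim_comp_inr, ← replicateCol_mulVec]
  rw [← matSO_mul_sub_mul, ← matSO_mulVec_anticomm (y ∘ .inl) (x ∘ .inr)]
  ext i j
  simp only [Matrix.sub_apply, submatrix_apply]
  generalize (finSumFinEquiv (m := 3) (n := 1)).symm i = i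
  generalize (finSumFinEquiv (m := 3) (n := 1)).symm j = j
  rcases i with i | i <;> rcases j with j | j <;> simp [neg_add_eq_sub]

lemma adMatrix_basisSE (x : I6 → ℝ) : adMatrix basisSE x = adSEvec x := by
  ext i j
  have hj : basisSE j = matSE (Pi.single j 1) := by
    rw [basisSE, Module.Basis.coe_ofEquivFun]
  have hx : basisSE.equivFun.symm x = matSE x := by
    rw [basisSE, Module.Basis.equivFun_ofEquivFun]
  calc adMatrix basisSE x i j
      = vecSE ⁅matSE x, matSE (Pi.single j 1)⁆ i := by rw [adMatrix_apply, hj, hx]; rfl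
    _ = adSEvec x i j := by
      rw [lie_matSE, LinearEquiv.apply_symm_apply, mulVec_single_one, col_apply]

lemma trace_transpose_matSE_mul_matSE (x y : I6 → ℝ) :
    ((matSE x : Matrix (Fin 4) (Fin 4) ℝ)ᵀ * (matSE y : Matrix (Fin 4) (Fin 4) ℝ)).trace =
      x ⬝ᵥ y := by
  simp only [trace, diag_apply, mul_apply, transpose_apply, coe_matSE, of_apply, cons_val',
    cons_val_fin_one, cons_val, Fin.sum_univ_four, mul_zero, zero_add, add_zero, neg_mul_neg,
    dotProduct, Fintype.sum_sum_type, Fin.sum_univ_three, div_mul_div_comm,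
    Real.mul_self_sqrt zero_le_two]
  ring

lemma diagonal_mul_coe_matSE (x : I6 → ℝ) :
    diagonal ![1, 1, 1, 0] * (matSE x : Matrix (Fin 4) (Fin 4) ℝ) =
      (matSE x : Matrix (Fin 4) (Fin 4) ℝ) := by
  ext i j
  rw [diagonal_mul, coe_matSE]
  fin_cases i <;> fin_cases j <;> simp

lemma transpose_coe_matSE_mul_diagonal (x : I6 → ℝ) :
    ((matSE x : Matrix (Fin 4) (Fin 4) ℝ) * diagonal ![1, 1, 1, 0])ᵀ =
      -((matSE x : Matrix (Fin 4) (Fin 4) ℝ) * diagonal ![1, 1, 1, 0]) := by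
  ext i j
  rw [transpose_apply, Matrix.neg_apply, mul_diagonal, mul_diagonal, coe_matSE]
  fin_cases i <;> fin_cases j <;> simp

lemma vecSE_prSE_dotProduct (A : Matrix (Fin 4) (Fin 4) ℝ) (x : I6 → ℝ) :
    vecSE (prSE A) ⬝ᵥ x = (Aᵀ * (matSE x : Matrix (Fin 4) (Fin 4) ℝ)).trace := by
  set B : Matrix (Fin 4) (Fin 4) ℝ := (matSE x : Matrix (Fin 4) (Fin 4) ℝ) with hB
  set D : Matrix (Fin 4) (Fin 4) ℝ := diagonal ![1, 1, 1, 0] with hD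
  set D' : Matrix (Fin 4) (Fin 4) ℝ := diagonal ![1, 1, 1, 2] with hD'
  have hpr : (prSE A : Matrix (Fin 4) (Fin 4) ℝ)ᵀ = (1 / 2 : ℝ) • ((D' * Aᵀ - D * A) * D) := by
    simp [prSE, hD, hD']
  have hadd : D' + D = (2 : ℝ) • 1 := by
    ext i j
    fin_cases i <;> fin_cases j <;> simp [hD, hD'] <;> norm_num
  have hskew : (D * A * B).trace = -(D * Aᵀ * B).trace :=
    calc (D * A * B).trace = (A * (B * D)).trace := by
          rw [mul_assoc, trace_mul_comm, mul_assoc]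
      _ = -(B * D * Aᵀ).trace := by
          rw [← trace_transpose, transpose_mul, transpose_coe_matSE_mul_diagonal, neg_mul,
            trace_neg]
      _ = -(D * Aᵀ * B).trace := by rw [mul_assoc, trace_mul_comm]
  calc vecSE (prSE A) ⬝ᵥ x
      = ((prSE A : Matrix (Fin 4) (Fin 4) ℝ)ᵀ * B).trace := by
        rw [hB, ← trace_transpose_matSE_mul_matSE, matSE, LinearEquiv.symm_apply_apply]
    _ = (1 / 2 : ℝ) * ((D' * Aᵀ * B).trace - (D * A * B).trace) := by
        rw [hpr, smul_mul, mul_assoc, diagonal_mul_coe_matSE, trace_smul, sub_mul, trace_sub,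
          smul_eq_mul]
    _ = (1 / 2 : ℝ) * ((D' + D) * Aᵀ * B).trace := by
        rw [hskew, sub_neg_eq_add, ← trace_add, add_mul, add_mul]
    _ = (Aᵀ * B).trace := by
        rw [hadd, smul_mul, one_mul, smul_mul, trace_smul, smul_eq_mul]
        ring

lemma itoMatrix_basisSE_diagonal (s : I12 → ℝ) :
    itoMatrix basisSE (diagonal fun i => s (.inl i)) =
      fromBlocks (explicitXi s) 0 0 (explicitXi s) := by
  have hrot (i : Fin 3) : adSEvec (Pi.single (.inl i) 1) ^ 2 =
      fromBlocks (matSO (Pi.single i 1) ^ 2) 0 0 (matSO (Pi.single i 1) ^ 2) := by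
    rw [adSEvec, ← Sum.elim_single_zero, Sum.elim_comp_inl, Sum.elim_comp_inr, matSO_zero,
      fromBlocks_diagonal_pow]
  have htrans (i : Fin 3) : adSEvec (Pi.single (.inr i) 1) ^ 2 = 0 := by
    rw [adSEvec, ← Sum.elim_zero_single, Sum.elim_comp_inl, Sum.elim_comp_inr, matSO_zero, pow_two,
      fromBlocks_multiply]
    simp
  rw [itoMatrix_diagonal, Fintype.sum_sum_type, ← sum_smul_matSO_single_sq]
  simp only [adMatrix_basisSE, hrot, htrans, smul_zero, Finset.sum_const_zero, add_zero]
  ext (i | i) (j | j) <;> simp [Matrix.sum_apply]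

end SE3Coordinates

section StateGroup

instance : IsLieAbelian (I6 → ℝ) := isMulCommutative_iff_isLieAbelian.1 inferInstance

lemma matG_apply (x : I12 → ℝ) : matG x = (matSE (x ∘ .inl), x ∘ .inr) := rfl

lemma vecG_apply (η : StateAlgebra) : vecG η = Sum.elim (vecSE η.1) η.2 := rfl

lemma velocity_mul_expG (G : StateGroup) (η : StateAlgebra) :
    velocity (G * expG η) = velocity G + η.2 := rfl

lemma stateGroup_eq_iff {G H : StateGroup} :
    G = H ↔ pose G = pose H ∧ velocity G = velocity H :=
  ⟨fun h => h ▸ ⟨rfl, rfl⟩, fun h => Prod.ext (Subtype.ext (Units.ext h.1)) h.2⟩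

lemma adMatrix_basisG (x : I12 → ℝ) : adMatrix basisG x = adGvec x := by
  rw [basisG_eq_prod, adMatrix_prod, adMatrix_basisSE, adMatrix_eq_zero, adGvec]

lemma itoMatrix_basisG_diagonal (s : I12 → ℝ) : itoMatrix basisG (diagonal s) = explicitC s := by
  rw [basisG_eq_prod, itoMatrix_prod, toBlocks₁₁_diagonal, itoMatrix_basisSE_diagonal,
    itoMatrix_eq_zero, explicitC]

lemma phiMatrix_basisG (x : I12 → ℝ) : phiMatrix basisG x = explicitPhi x := by
  rw [basisG_eq_prod, phiMatrix_prod, phiMatrix_eq_one (Pi.basisFun ℝ I6), explicitPhi, phiSE,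
    phiMatrix]
  simp only [adMatrix_basisSE]

end StateGroup

section LeftJacobian

lemma HasLeftJacobian.leftJacobian_eq {κ : Type*} [Fintype κ] {φ : StateGroup → κ → ℝ}
    {G : StateGroup} {D : Matrix κ I12 ℝ} (h : HasLeftJacobian φ G D) :
    leftJacobian φ G = D := by
  rw [leftJacobian, HasFDerivAt.fderiv h]
  exact LinearMap.toMatrix'_toLin' D

lemma HasLeftJacobian.sum {ι κ : Type*} [Fintype κ] {s : Finset ι}
    {φ : ι → StateGroup → κ → ℝ} {G : StateGroup} {D : ι → Matrix κ I12 ℝ}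
    (h : ∀ i ∈ s, HasLeftJacobian (φ i) G (D i)) :
    HasLeftJacobian (fun G' => ∑ i ∈ s, φ i G') G (∑ i ∈ s, D i) := by
  have hD : LinearMap.toContinuousLinearMap (∑ i ∈ s, D i).mulVecLin =
      ∑ i ∈ s, LinearMap.toContinuousLinearMap (D i).mulVecLin := by
    ext1 x
    simp
  rw [HasLeftJacobian, hD]
  exact HasFDerivAt.fun_sum h

lemma explicitHk_mulVec (a : Fin 4 → ℝ) (E : Matrix (Fin 4) (Fin 4) ℝ) (x : I12 → ℝ) :
    explicitHk a E *ᵥ x = (E * (matSE (x ∘ .inl) : Matrix (Fin 4) (Fin 4) ℝ)) *ᵥ a := by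
  ext i
  set B : Matrix (Fin 4) (Fin 4) ℝ := (matSE (x ∘ .inl) : Matrix (Fin 4) (Fin 4) ℝ)
  calc (explicitHk a E *ᵥ x) i
      = vecSE (prSE (Eᵀ * vecMulVec (Pi.single i 1) a)) ⬝ᵥ (x ∘ .inl) := by
        simp [mulVec, explicitHk, dotProduct, Fintype.sum_sum_type]
    _ = (vecMulVec a (Pi.single i 1) * (E * B)).trace := by
        rw [vecSE_prSE_dotProduct, transpose_mul, transpose_transpose, transpose_vecMulVec,
          mul_assoc]
    _ = ((E * B) *ᵥ a) i := by
        rw [vecMulVec_mul, trace_vecMulVec, single_one_vecMul, dotProduct_comm]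
        rfl

section
attribute [local instance] Matrix.linftyOpNormedRing Matrix.linftyOpNormedAlgebra

lemma hasFDerivAt_pose_mul_expG (G : StateGroup) :
    HasFDerivAt (fun x : I12 → ℝ => pose (G * expG (matG x)))
      (LinearMap.toContinuousLinearMap (LinearMap.mulLeft ℝ (pose G) ∘ₗ
        se3.toSubmodule.subtype ∘ₗ vecSE.symm.toLinearMap ∘ₗ LinearMap.funLeft ℝ ℝ .inl)) 0 := by
  let T : (I12 → ℝ) →L[ℝ] Matrix (Fin 4) (Fin 4) ℝ :=
    LinearMap.toContinuousLinearMap (se3.toSubmodule.subtype ∘ₗ vecSE.symm.toLinearMap ∘ₗ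
      LinearMap.funLeft ℝ ℝ (.inl : I6 → I12))
  have hexp : HasFDerivAt (NormedSpace.exp : Matrix (Fin 4) (Fin 4) ℝ → _)
      (1 : Matrix (Fin 4) (Fin 4) ℝ →L[ℝ] Matrix (Fin 4) (Fin 4) ℝ) (T 0) := by
    rw [map_zero]
    exact hasFDerivAt_exp_zero
  exact (LinearMap.toContinuousLinearMap (LinearMap.mulLeft ℝ (pose G))).hasFDerivAt.comp
    (0 : I12 → ℝ) (hexp.comp (0 : I12 → ℝ) T.hasFDerivAt)

lemma hasLeftJacobian_linearObs (a : Fin 4 → ℝ) (G : StateGroup) :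
    HasLeftJacobian (linearObs a) G (explicitHk a (pose G)) := by
  refine ((LinearMap.toContinuousLinearMap ((Matrix.mulVecBilin ℝ ℝ).flip a)).hasFDerivAt.comp
    (0 : I12 → ℝ) (hasFDerivAt_pose_mul_expG G)).congr_fderiv ?_
  ext1 x
  exact (explicitHk_mulVec a (pose G) x).symm

end

lemma hasLeftJacobian_sum_linearObs {n : ℕ} (a : Fin n → Fin 4 → ℝ) (G : StateGroup) :
    HasLeftJacobian (fun G' => ∑ k, linearObs (a k) G') G (explicitH a (pose G)) :=
  HasLeftJacobian.sum fun k _ => hasLeftJacobian_linearObs (a k) G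

lemma hasLeftJacobian_constAccDrift (G : StateGroup) :
    HasLeftJacobian (fun G' => vecG (constAccDrift G')) G explicitF := by
  have haffine (x : I12 → ℝ) : vecG (constAccDrift (G * expG (matG x))) =
      LinearMap.toContinuousLinearMap explicitF.mulVecLin x + Sum.elim (velocity G) 0 := by
    rw [vecG_apply, constAccDrift, velocity_mul_expG, matG_apply]
    ext (i | i) <;> simp [explicitF, fromBlocks_mulVec, add_comm]
  simp only [HasLeftJacobian, haffine]
  exact (ContinuousLinearMap.hasFDerivAt _).add_const _

lemma driftJacobian_constAccDrift (S : Matrix I12 I12 ℝ) (G : StateGroup) :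
    driftJacobian constAccDrift S G = explicitJ (itoMatrix basisG S) (velocity G) := by
  rw [driftJacobian, (hasLeftJacobian_constAccDrift G).leftJacobian_eq, adMatrix_basisG,
    vecG_apply, constAccDrift, matSE, LinearEquiv.apply_symm_apply, explicitJ]

end LeftJacobian

theorem isEKFStep_iff_isAlgorithmStep {n : ℕ} (a : Fin n → Fin 4 → ℝ)
    (S : Matrix I12 I12 ℝ) (Q : Matrix (Fin 4) (Fin 4) ℝ) (t₀ t₁ : ℝ)
    (y : Fin n → Fin 4 → ℝ) (G₀ : StateGroup) (P₀ : Matrix I12 I12 ℝ)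
    (Gc : ℝ → StateGroup) (Pc : ℝ → Matrix I12 I12 ℝ)
    (K : Matrix I12 (Fin 4) ℝ) (m : I12 → ℝ) (G₁ : StateGroup) (P₁ : Matrix I12 I12 ℝ) :
    IsEKFStep constAccDrift (fun G' => ∑ k, linearObs (a k) G') S Q t₀ t₁ (∑ k, y k)
        G₀ P₀ Gc Pc K m G₁ P₁ ↔
      IsAlgorithmStep a (itoMatrix basisG S) S Q t₀ t₁ y G₀ P₀ Gc Pc K m G₁ P₁ := by
  have hH := (hasLeftJacobian_sum_linearObs a (Gc t₁)).leftJacobian_eq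
  have hresidual : ∑ k, y k - ∑ k, linearObs (a k) (Gc t₁) =
      ∑ k, (y k - pose (Gc t₁) *ᵥ a k) := (Finset.sum_sub_distrib _ _).symm
  constructor
  · intro h
    exact {
      state_init := h.state_init
      cov_init := h.cov_init
      pose_ode := fun t ht => (h.state_ode t ht).1
      velocity_ode := fun t ht => (h.state_ode t ht).2
      cov_posSemidef := h.cov_posSemidef
      cov_ode := by simpa only [driftJacobian_constAccDrift, adMatrix_basisG] using h.cov_ode
      gain := by simpa only [hH] using h.gain
      correction := by simpa only [hresidual] using h.correction
      pose_update := (stateGroup_eq_iff.1 h.state_update).1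
      velocity_update := (stateGroup_eq_iff.1 h.state_update).2
      cov_update := by simpa only [hH, phiMatrix_basisG] using h.cov_update }
  · intro h
    exact {
      state_init := h.state_init
      cov_init := h.cov_init
      state_ode := fun t ht => ⟨h.pose_ode t ht, h.velocity_ode t ht⟩
      cov_posSemidef := h.cov_posSemidef
      cov_ode := by simpa only [driftJacobian_constAccDrift, adMatrix_basisG] using h.cov_ode
      gain := by simpa only [hH] using h.gain
      correction := by simpa only [hresidual] using h.correction
      state_update := stateGroup_eq_iff.2 ⟨h.pose_update, h.velocity_update⟩
      cov_update := by simpa only [hH, phiMatrix_basisG] using h.cov_update }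

end LieEKF

theorem mainTheorem5 (n : ℕ) (a : Fin n → Fin 4 → ℝ) :
    -- the differential of the `k`-th observation function is the explicit `4 × 12` matrix
    (∀ (G : StateGroup) (k : Fin n),
      HasLeftJacobian (linearObs (a k)) G (explicitHk (a k) (pose G))) ∧
    -- the differential of the summed observation function is `H = ∑ₖ Hᵏ`
    (∀ G : StateGroup,
      HasLeftJacobian (fun G' => ∑ k, linearObs (a k) G') G (explicitH a (pose G)) ∧
      leftJacobian (fun G' => ∑ k, linearObs (a k) G') G = explicitH a (pose G)) ∧
    -- the differential of the drift is `F`, and the adjoint matrix has the stated block form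
    (∀ G : StateGroup,
      HasLeftJacobian (fun G' => vecG (constAccDrift G')) G explicitF) ∧
    (∀ x : I12 → ℝ, adMatrix basisG x = adGvec x) ∧
    -- `J` is as stated, with the explicit `C(S)` if `S` is diagonal
    (∀ (S : Matrix I12 I12 ℝ) (G : StateGroup),
      driftJacobian constAccDrift S G = explicitJ (itoMatrix basisG S) (velocity G)) ∧
    (∀ s : I12 → ℝ, itoMatrix basisG (Matrix.diagonal s) = explicitC s) ∧
    -- `Φ` has the stated block form
    (∀ x : I12 → ℝ, phiMatrix basisG x = explicitPhi x) ∧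
    -- the extended Kalman filter is the explicit algorithm
    (∀ (S : Matrix I12 I12 ℝ) (Q : Matrix (Fin 4) (Fin 4) ℝ) (t₀ t₁ : ℝ)
      (y : Fin n → Fin 4 → ℝ) (G₀ : StateGroup) (P₀ : Matrix I12 I12 ℝ)
      (Gc : ℝ → StateGroup) (Pc : ℝ → Matrix I12 I12 ℝ)
      (K : Matrix I12 (Fin 4) ℝ) (m : I12 → ℝ) (G₁ : StateGroup) (P₁ : Matrix I12 I12 ℝ),
      S.PosSemidef → Q.PosDef → t₀ < t₁ →
      (IsEKFStep constAccDrift (fun G' => ∑ k, linearObs (a k) G') S Q t₀ t₁ (∑ k, y k)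
          G₀ P₀ Gc Pc K m G₁ P₁ ↔
        IsAlgorithmStep a (itoMatrix basisG S) S Q t₀ t₁ y G₀ P₀ Gc Pc K m G₁ P₁)) ∧
    (∀ (s : I12 → ℝ) (Q : Matrix (Fin 4) (Fin 4) ℝ) (t₀ t₁ : ℝ)
      (y : Fin n → Fin 4 → ℝ) (G₀ : StateGroup) (P₀ : Matrix I12 I12 ℝ)
      (Gc : ℝ → StateGroup) (Pc : ℝ → Matrix I12 I12 ℝ)
      (K : Matrix I12 (Fin 4) ℝ) (m : I12 → ℝ) (G₁ : StateGroup) (P₁ : Matrix I12 I12 ℝ),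
      (∀ i, 0 ≤ s i) → Q.PosDef → t₀ < t₁ →
      (IsEKFStep constAccDrift (fun G' => ∑ k, linearObs (a k) G') (Matrix.diagonal s) Q t₀ t₁
          (∑ k, y k) G₀ P₀ Gc Pc K m G₁ P₁ ↔
        IsAlgorithmStep a (explicitC s) (Matrix.diagonal s) Q t₀ t₁ y
          G₀ P₀ Gc Pc K m G₁ P₁)) := by
  refine ⟨fun G k => hasLeftJacobian_linearObs (a k) G,
    fun G => ⟨hasLeftJacobian_sum_linearObs a G,
      (hasLeftJacobian_sum_linearObs a G).leftJacobian_eq⟩,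
    hasLeftJacobian_constAccDrift, adMatrix_basisG, driftJacobian_constAccDrift,
    itoMatrix_basisG_diagonal, phiMatrix_basisG, ?_, ?_⟩
  · intro S Q t₀ t₁ y G₀ P₀ Gc Pc K m G₁ P₁ _ _ _
    exact isEKFStep_iff_isAlgorithmStep a S Q t₀ t₁ y G₀ P₀ Gc Pc K m G₁ P₁
  · intro s Q t₀ t₁ y G₀ P₀ Gc Pc K m G₁ P₁ _ _ _
    rw [← itoMatrix_basisG_diagonal s]
    exact isEKFStep_iff_isAlgorithmStep a _ Q t₀ t₁ y G₀ P₀ Gc Pc K m G₁ P₁
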